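/- All graphs are simple and may be infinite. A graph is infinitely edge-connected if it has at least two vertices and it remains connected after the deletion of any finite set of edges. A \emph{$\Pi$-graph} is an infinitely edge-connected graph $G$ such that, for any two distinct vertices $u,v$ of $G$, there are not infinitely many $u$--$v$ paths in $G$ that pairwise have only $u$ and $v$ in common. The \emph{Farey graph} is the graph on $\mathbb{Q}\cup\{\infty\}$ in which $a/b$ and $c/d$, written in lowest terms (with $\infty=(\pm 1)/0$), are adjacent if and only if $\det\begin{pmatrix} a & c\\ b & d\end{pmatrix}=\pm 1$. A graph $H$ is a \emph{tight minor} of a graph $G$ if there are finite, pairwise disjoint vertex sets $B_w\subseteq V(G)$, one for every vertex $w$ of $H$, such that each $B_w$ is non-empty and induces a connected subgraph of $G$, and $G$ has an edge between $B_w$ and $B_{w'}$ whenever $ww'$ is an edge of $H$. \textbf{Theorem 2.} Every $\Pi$-graph contains the Farey graph as a tight minor. -/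

import Mathlib

namespace SimpleGraph

/-- Two `u`-`v` paths are independent if they have no vertex in common other than `u` and `v`. -/
def Path.Independent {V : Type*} {G : SimpleGraph V} {u v : V} (P Q : G.Path u v) : Prop :=
  ∀ x, x ∈ P.1.support → x ∈ Q.1.support → x = u ∨ x = v

/-- A graph is infinitely edge-connected if it has at least two vertices and it is
`k`-edge-connected for every natural number `k`. -/
def IsInfinitelyEdgeConnected {V : Type*} (G : SimpleGraph V) : Prop :=
  Nontrivial V ∧ ∀ k : ℕ, G.IsEdgeConnected k

/-- A `Π`-graph is an infinitely edge-connected graph that does not contain infinitely many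
(pairwise) independent paths between any two of its vertices. -/
def IsPiGraph {V : Type*} (G : SimpleGraph V) : Prop :=
  G.IsInfinitelyEdgeConnected ∧
    ∀ u v : V, u ≠ v →
      ¬ ∃ S : Set (G.Path u v), S.Infinite ∧ S.Pairwise Path.Independent

/-- A model of `H` as a minor of `G`: pairwise disjoint, connected (in particular non-empty)
vertex sets of `G`, one for every vertex of `H`, such that `G` has an edge between any two of
them that belong to adjacent vertices of `H`. -/
structure MinorModel {W V : Type*} (H : SimpleGraph W) (G : SimpleGraph V) where
  /-- the branch set of a vertex of `H` -/
  branchSet : W → Set V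
  connected : ∀ w, (G.induce (branchSet w)).Connected
  disjoint : ∀ w w', w ≠ w' → Disjoint (branchSet w) (branchSet w')
  exists_adj : ∀ w w', H.Adj w w' → ∃ a ∈ branchSet w, ∃ b ∈ branchSet w', G.Adj a b

/-- `H` is a tight minor of `G`: a minor with finite branch sets. -/
def IsTightMinor {W V : Type*} (H : SimpleGraph W) (G : SimpleGraph V) : Prop :=
  ∃ M : MinorModel H G, ∀ w, (M.branchSet w).Finite

end SimpleGraph

/-- The numerator of an element of `ℚ ∪ {∞}` written in lowest terms, with `∞ = 1 / 0`. -/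
def fareyNum : OnePoint ℚ → ℤ
  | none => 1
  | some q => q.num

/-- The denominator of an element of `ℚ ∪ {∞}` written in lowest terms, with `∞ = 1 / 0`. -/
def fareyDen : OnePoint ℚ → ℤ
  | none => 0
  | some q => q.den

/-- The Farey graph: the graph on `ℚ ∪ {∞}` in which `a / b` and `c / d`, in lowest terms, are
adjacent if and only if the determinant of the matrix with rows `(a, c)` and `(b, d)` is
`1` or `-1`. -/
def fareyGraph : SimpleGraph (OnePoint ℚ) where
  Adj x y :=
    !![fareyNum x, fareyNum y; fareyDen x, fareyDen y].det = 1 ∨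
      !![fareyNum x, fareyNum y; fareyDen x, fareyDen y].det = -1
  symm := by
    constructor
    intro x y h
    simp only [Matrix.det_fin_two_of] at h ⊢
    rcases h with h | h
    · right; linarith
    · left; linarith
  loopless := by
    constructor
    intro x h
    simp only [Matrix.det_fin_two_of] at h
    rcases h with h | h <;> linarith

/-! Call `K` a region between finite sets `X` and `Y` if every cut separating `X` from `Y` in `X ∪ K
∪ Y` is infinite. The engine is `IsFareyRegion.exists_split`: a region contains a finite connected
set `Z` touching both ends, with disjoint regions on either side, one between `X` and `Z` and one
between `Z` and `Y`. Finiteness comes from the `Π`-property: with finite ends, infinitely many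
disjoint links would yield infinitely many independent paths, so some finite set meets every link
(`IsPiGraph.exists_finite_hitting`), and `Z` is chosen to contain the relevant part of it.

Iterated splitting mirrors the insertion of mediants. A coprime pair is located by the subtractive
Euclidean algorithm, which preserves determinants; this gives adjacency (`touches_branch`) and
disjointness (`disjoint_branch`) on the half of the Farey graph on one side of the edge from 0 to ∞.
The two halves come from two cells with the same ends and disjoint regions
(`IsPiGraph.exists_fareyCell_pair`). -/

namespace SimpleGraph

variable {V : Type*} {G : SimpleGraph V}

/-! ### Infinite cuts, links, and finite hitting sets -/

/-- The edges of `G` from `A` to `B`, as ordered pairs. -/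
def edgesBetween (G : SimpleGraph V) (A B : Set V) : Set (V × V) :=
  {p | p.1 ∈ A ∧ p.2 ∈ B ∧ G.Adj p.1 p.2}

/-- Some edge of `G` joins `A` to `B`. -/
def Touches (G : SimpleGraph V) (A B : Set V) : Prop :=
  ∃ a ∈ A, ∃ b ∈ B, G.Adj a b

theorem Touches.symm {A B : Set V} (h : G.Touches A B) : G.Touches B A := by
  obtain ⟨a, ha, b, hb, hab⟩ := h
  exact ⟨b, hb, a, ha, hab.symm⟩

theorem Touches.mono {A A' B B' : Set V} (h : G.Touches A B) (hA : A ⊆ A') (hB : B ⊆ B') :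
    G.Touches A' B' := by
  obtain ⟨a, ha, b, hb, hab⟩ := h
  exact ⟨a, hA ha, b, hB hb, hab⟩

theorem finite_edgesBetween {A B : Set V} (hA : A.Finite) (hB : B.Finite) :
    (G.edgesBetween A B).Finite :=
  (hA.prod hB).subset fun _ hp ↦ ⟨hp.1, hp.2.1⟩

theorem finite_edgesBetween_swap {A B : Set V} (h : (G.edgesBetween A B).Finite) :
    (G.edgesBetween B A).Finite :=
  (h.image Prod.swap).subset fun p hp ↦ ⟨p.swap, ⟨hp.2.1, hp.1, hp.2.2.symm⟩, by simp⟩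

theorem infinite_edgesBetween_compl (hG : G.IsInfinitelyEdgeConnected) {P : Set V} {u v : V}
    (hu : u ∈ P) (hv : v ∉ P) : (G.edgesBetween P Pᶜ).Infinite := by
  intro hfin
  set F : Set (Sym2 V) := (fun p : V × V ↦ s(p.1, p.2)) '' G.edgesBetween P Pᶜ with hF
  have hFfin : F.Finite := hfin.image _
  have hlt : F.encard < ((F.ncard + 1 : ℕ) : ℕ∞) := by
    rw [← hFfin.cast_ncard_eq]
    exact_mod_cast Nat.lt_succ_self _
  obtain ⟨p⟩ := hG.2 (F.ncard + 1) u v hlt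
  obtain ⟨d, -, h₁, h₂⟩ := p.exists_boundary_dart P hu hv
  have hd := d.adj
  rw [deleteEdges_adj] at hd
  exact hd.2 ⟨(d.fst, d.snd), ⟨h₁, h₂, hd.1⟩, rfl⟩

/-- A connected vertex set contains finite connected sets around any of its finite subsets. -/
theorem exists_finite_connected_superset {C S : Set V} (hC : (G.induce C).Connected)
    (hS : S.Finite) (hSC : S ⊆ C) (hne : S.Nonempty) :
    ∃ Z, S ⊆ Z ∧ Z ⊆ C ∧ Z.Finite ∧ (G.induce Z).Connected := by
  classical
  have hpre : (Subtype.val ⁻¹' S : Set C).Finite := hS.preimage Subtype.val_injective.injOn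
  obtain ⟨t, ht, htc⟩ := (G.induce C).extend_finset_to_connected hC.preconnected
    (t := hpre.toFinset) (by
      obtain ⟨s, hs⟩ := hne
      exact ⟨⟨s, hSC hs⟩, by simpa using hs⟩)
  refine ⟨Subtype.val '' (t : Set C), ?_, ?_, t.finite_toSet.image _, ?_⟩
  · intro s hs
    exact ⟨⟨s, hSC hs⟩, ht (by simpa using hs), rfl⟩
  · rintro _ ⟨x, -, rfl⟩
    exact x.2
  · refine htc.map (f := ⟨fun x ↦ ⟨x.1.1, x.1, x.2, rfl⟩, fun h ↦ h⟩) ?_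
    rintro ⟨_, x, hx, rfl⟩
    exact ⟨⟨x, hx⟩, rfl⟩

/-- A finite connected set that touches both `X` and `Y`. -/
structure IsLink (G : SimpleGraph V) (X Y L : Set V) : Prop where
  finite : L.Finite
  connected : (G.induce L).Connected
  touches_left : G.Touches X L
  touches_right : G.Touches L Y

/-- A connected set that touches both `X` and `Y` contains a link. -/
theorem exists_isLink_subset {X Y C : Set V} (hC : (G.induce C).Connected)
    (hX : G.Touches X C) (hY : G.Touches C Y) : ∃ L ⊆ C, G.IsLink X Y L := by
  obtain ⟨x, hx, a, ha, hxa⟩ := hX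
  obtain ⟨b, hb, y, hy, hby⟩ := hY
  obtain ⟨Z, hSZ, hZC, hfin, hcon⟩ := exists_finite_connected_superset hC
    (Set.toFinite {a, b}) (by rintro _ (rfl | rfl) <;> assumption) ⟨a, by simp⟩
  exact ⟨Z, hZC, hfin, hcon, ⟨x, hx, a, hSZ (by simp), hxa⟩, ⟨b, hSZ (by simp), y, hy, hby⟩⟩

/-- A connected set adjacent to `x` and `y` and avoiding both is traversed by an `x`-`y` path. -/
theorem exists_path_through {x y : V} {L : Set V} (hxy : x ≠ y) (hL : (G.induce L).Connected)
    (hxL : x ∉ L) (hyL : y ∉ L) (hx : G.Touches {x} L) (hy : G.Touches L {y}) :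
    ∃ P : G.Path x y, (∀ z ∈ P.1.support, z = x ∨ z = y ∨ z ∈ L) ∧ ∃ z ∈ P.1.support, z ∈ L := by
  classical
  obtain ⟨_, rfl, a, ha, hxa⟩ := hx
  obtain ⟨b, hb, _, rfl, hby⟩ := hy
  obtain ⟨p⟩ := hL.preconnected ⟨a, ha⟩ ⟨b, hb⟩
  let q : G.Walk a b := p.toPath.1.map (Embedding.induce L).toHom
  have hq : q.IsPath := p.toPath.2.map Subtype.val_injective
  have hqL : ∀ z ∈ q.support, z ∈ L := by
    intro z hz
    have hz : z ∈ (p.toPath.1.map (Embedding.induce L).toHom).support := hz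
    rw [Walk.support_map, List.mem_map] at hz
    obtain ⟨w, -, rfl⟩ := hz
    exact w.2
  have hpath : (Walk.cons hxa (q.concat hby)).IsPath := by
    rw [Walk.cons_isPath_iff, Walk.concat_isPath_iff]
    refine ⟨⟨hq, fun h ↦ hyL (hqL _ h)⟩, fun h ↦ ?_⟩
    rw [Walk.support_concat, List.mem_append, List.mem_singleton] at h
    exact h.elim (fun h ↦ hxL (hqL _ h)) hxy
  refine ⟨⟨_, hpath⟩, ?_, a, ?_, ha⟩
  · intro z hz
    rw [Walk.support_cons, Walk.support_concat] at hz
    simp only [List.mem_cons, List.mem_append, List.not_mem_nil,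
      or_false] at hz
    rcases hz with h | h | h
    exacts [.inl h, .inr (.inr (hqL _ h)), .inr (.inl h)]
  · rw [Walk.support_cons, Walk.support_concat]
    simp

/-- In a `Π`-graph finitely many vertices meet all links between two finite sets. -/
theorem IsPiGraph.exists_finite_hitting (hG : G.IsPiGraph) {X Y K : Set V} (hX : X.Finite)
    (hY : Y.Finite) (hXY : Disjoint X Y) (hXK : Disjoint X K) (hYK : Disjoint Y K) :
    ∃ S : Set V, S.Finite ∧ ∀ L ⊆ K, G.IsLink X Y L → (L ∩ S).Nonempty := by
  classical
  by_contra! hcon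
  obtain ⟨f, hf, hdisj⟩ := exists_seq_of_forall_finset_exists'
    (fun L : Set V ↦ L ⊆ K ∧ G.IsLink X Y L) Disjoint (by
      intro s hs
      obtain ⟨L, hLK, hL, hempty⟩ := hcon (⋃ M ∈ s, M)
        (s.finite_toSet.biUnion fun M hM ↦ (hs M hM).2.finite)
      refine ⟨L, ⟨hLK, hL⟩, fun M hM ↦ ?_⟩
      rw [Set.disjoint_iff_inter_eq_empty, ← Set.subset_empty_iff, ← hempty]
      exact fun z hz ↦ ⟨hz.2, Set.mem_biUnion hM hz.1⟩)
  have hends : ∀ n, ∃ e : X × Y, G.Touches {e.1.1} (f n) ∧ G.Touches (f n) {e.2.1} := by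
    intro n
    obtain ⟨x, hx, a, ha, hxa⟩ := (hf n).2.touches_left
    obtain ⟨b, hb, y, hy, hby⟩ := (hf n).2.touches_right
    exact ⟨(⟨x, hx⟩, ⟨y, hy⟩), ⟨x, rfl, a, ha, hxa⟩, ⟨b, hb, y, rfl, hby⟩⟩
  choose e he using hends
  have := hX.to_subtype
  have := hY.to_subtype
  -- There are only finitely many pairs of ends, so infinitely many of the disjoint links share one.
  obtain ⟨⟨x, y⟩, hxy⟩ := Finite.exists_infinite_fiber e
  have hne : x.1 ≠ y.1 := hXY.ne_of_mem x.2 y.2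
  have hpaths : ∀ n : e ⁻¹' {(x, y)}, ∃ P : G.Path x.1 y.1,
      (∀ z ∈ P.1.support, z = x.1 ∨ z = y.1 ∨ z ∈ f n) ∧ ∃ z ∈ P.1.support, z ∈ f n := by
    rintro ⟨n, hn⟩
    have hen : e n = (x, y) := hn
    have hen' := he n
    rw [hen] at hen'
    exact exists_path_through hne (hf n).2.connected
      (fun h ↦ hXK.ne_of_mem x.2 ((hf n).1 h) rfl) (fun h ↦ hYK.ne_of_mem y.2 ((hf n).1 h) rfl)
      hen'.1 hen'.2
  choose P hP hP' using hpaths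
  have hmeet : ∀ i j, i ≠ j → ∀ z ∈ (P i).1.support, z ∈ (P j).1.support → z = x.1 ∨ z = y.1 := by
    intro i j hij z hi hj
    have hd : Disjoint (f i) (f j) := hdisj (Subtype.coe_injective.ne hij)
    rcases hP i z hi with h | h | h
    · exact .inl h
    · exact .inr h
    rcases hP j z hj with h' | h' | h'
    · exact .inl h'
    · exact .inr h'
    exact absurd rfl (hd.ne_of_mem h h')
  refine hG.2 x.1 y.1 hne ⟨Set.range P, Set.infinite_range_of_injective ?_, ?_⟩
  · intro i j hPij
    by_contra hij
    obtain ⟨z, hz, hzf⟩ := hP' i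
    rcases hmeet i j hij z hz (hPij ▸ hz) with rfl | rfl
    · exact hXK.ne_of_mem x.2 ((hf i).1 hzf) rfl
    · exact hYK.ne_of_mem y.2 ((hf i).1 hzf) rfl
  · rintro _ ⟨i, rfl⟩ _ ⟨j, rfl⟩ hPij
    exact hmeet i j fun h ↦ hPij (congrArg P h)

/-! ### Regions and their splitting -/

/-- Finite sets `X` and `Y` that cannot be separated by finitely many edges in the graph that
consists of `X`, `Y` and the vertices in `K`, even when `X` and `Y` are contracted. -/
structure IsFareyRegion (G : SimpleGraph V) (X Y K : Set V) : Prop where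
  finite_left : X.Finite
  finite_right : Y.Finite
  disjoint : Disjoint X Y
  disjoint_left : Disjoint X K
  disjoint_right : Disjoint Y K
  infinite_cut : ∀ P ⊆ K, (G.edgesBetween (X ∪ P) ((K \ P) ∪ Y)).Infinite

theorem IsFareyRegion.symm {X Y K : Set V} (h : G.IsFareyRegion X Y K) :
    G.IsFareyRegion Y X K where
  finite_left := h.finite_right
  finite_right := h.finite_left
  disjoint := h.disjoint.symm
  disjoint_left := h.disjoint_right
  disjoint_right := h.disjoint_left
  infinite_cut P hP hfin := by
    refine h.infinite_cut (K \ P) Set.sdiff_subset ?_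
    rw [Set.sdiff_sdiff_cancel_left hP, Set.union_comm X, Set.union_comm P]
    exact finite_edgesBetween_swap hfin

theorem IsFareyRegion.touches_left {X Y K : Set V} (h : G.IsFareyRegion X Y K) :
    G.Touches X K := by
  by_contra hcon
  refine h.infinite_cut ∅ (Set.empty_subset _)
    ((G.finite_edgesBetween h.finite_left h.finite_right).subset ?_)
  rintro ⟨a, b⟩ ⟨ha, hb, hab⟩
  simp only [Set.union_empty, Set.sdiff_empty] at ha hb
  rcases hb with hb | hb
  · exact absurd ⟨a, ha, b, hb, hab⟩ hcon
  · exact ⟨ha, hb, hab⟩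

theorem IsFareyRegion.touches_right {X Y K : Set V} (h : G.IsFareyRegion X Y K) :
    G.Touches K Y :=
  h.symm.touches_left.symm

/-- Some component of a region is a region again. -/
theorem IsFareyRegion.exists_connected (hG : G.IsPiGraph) {X Y K : Set V}
    (h : G.IsFareyRegion X Y K) :
    ∃ C ⊆ K, (G.induce C).Connected ∧ G.IsFareyRegion X Y C := by
  obtain ⟨S, hS, hhit⟩ := hG.exists_finite_hitting h.finite_left h.finite_right h.disjoint
    h.disjoint_left h.disjoint_right
  let comp : (G.induce K).ConnectedComponent → Set V := fun c ↦ Subtype.val '' c.supp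
  have hsub : ∀ c, comp c ⊆ K := by
    rintro c _ ⟨v, -, rfl⟩
    exact v.2
  have hconn : ∀ c, (G.induce (comp c)).Connected := by
    intro c
    refine c.connected_toSimpleGraph.map (f := ⟨fun x ↦ ⟨x.1.1, x.1, x.2, rfl⟩, fun h ↦ h⟩) ?_
    rintro ⟨_, x, hx, rfl⟩
    exact ⟨⟨x, hx⟩, rfl⟩
  by_contra! hcon
  -- A component that avoids `S` contains no link, hence misses `X` or `Y`. Putting it entirely on
  -- one side then cuts only `X`–`Y` edges. As only finitely many components meet `S`, the union of
  -- all these cuts is finite.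
  have hcut : ∀ c, ∃ P ⊆ comp c, (G.edgesBetween (X ∪ P) ((comp c \ P) ∪ Y)).Finite ∧
      ((comp c ∩ S) = ∅ → G.edgesBetween (X ∪ P) ((comp c \ P) ∪ Y) ⊆ G.edgesBetween X Y) := by
    intro c
    have hXY := G.finite_edgesBetween h.finite_left h.finite_right
    by_cases hX : G.Touches X (comp c)
    · by_cases hY : G.Touches (comp c) Y
      · have hnot := hcon _ (hsub c) (hconn c)
        have : ∃ P ⊆ comp c, (G.edgesBetween (X ∪ P) ((comp c \ P) ∪ Y)).Finite := by
          by_contra! hinf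
          exact hnot ⟨h.finite_left, h.finite_right, h.disjoint,
            h.disjoint_left.mono_right (hsub c), h.disjoint_right.mono_right (hsub c), hinf⟩
        obtain ⟨P, hP, hfin⟩ := this
        refine ⟨P, hP, hfin, fun hempty ↦ ?_⟩
        obtain ⟨L, hLc, hL⟩ := exists_isLink_subset (hconn c) hX hY
        obtain ⟨z, hz, hzS⟩ := hhit L (hLc.trans (hsub c)) hL
        exact absurd (show z ∈ comp c ∩ S from ⟨hLc hz, hzS⟩) (by simp [hempty])
      · have hle : G.edgesBetween (X ∪ comp c) ((comp c \ comp c) ∪ Y) ⊆ G.edgesBetween X Y := by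
          rintro ⟨a, b⟩ ⟨ha, hb, hab⟩
          simp only [Set.sdiff_self, Set.empty_union] at hb
          exact ⟨ha.resolve_right fun ha ↦ hY ⟨a, ha, b, hb, hab⟩, hb, hab⟩
        exact ⟨_, subset_rfl, hXY.subset hle, fun _ ↦ hle⟩
    · have hle : G.edgesBetween (X ∪ ∅) ((comp c \ ∅) ∪ Y) ⊆ G.edgesBetween X Y := by
        rintro ⟨a, b⟩ ⟨ha, hb, hab⟩
        simp only [Set.union_empty, Set.sdiff_empty] at ha hb
        exact ⟨ha, hb.resolve_left fun hb ↦ hX ⟨a, ha, b, hb, hab⟩, hab⟩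
      exact ⟨∅, Set.empty_subset _, hXY.subset hle, fun _ ↦ hle⟩
  choose P hP hPfin hPempty using hcut
  have hT : {c | (comp c ∩ S).Nonempty}.Finite := by
    have hpre : (Subtype.val ⁻¹' S : Set K).Finite := hS.preimage Subtype.val_injective.injOn
    refine (hpre.image (G.induce K).connectedComponentMk).subset ?_
    rintro c ⟨_, ⟨v, hv, rfl⟩, hvS⟩
    exact ⟨v, hvS, hv⟩
  refine h.infinite_cut (⋃ c, P c) (Set.iUnion_subset fun c ↦ (hP c).trans (hsub c))
    (((hT.biUnion fun c _ ↦ hPfin c).union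
      (G.finite_edgesBetween h.finite_left h.finite_right)).subset ?_)
  have key : ∀ c, G.edgesBetween (X ∪ P c) ((comp c \ P c) ∪ Y) ⊆
      (⋃ c ∈ {c | (comp c ∩ S).Nonempty}, G.edgesBetween (X ∪ P c) ((comp c \ P c) ∪ Y)) ∪
        G.edgesBetween X Y := by
    intro c p hp
    by_cases hc : (comp c ∩ S).Nonempty
    · exact .inl (Set.mem_biUnion (x := c) hc hp)
    · exact .inr (hPempty c (Set.not_nonempty_iff_eq_empty.1 hc) hp)
  rintro ⟨a, b⟩ ⟨ha, hb, hab⟩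
  rcases hb with ⟨hbK, hbP⟩ | hb
  · have hbc : b ∈ comp ((G.induce K).connectedComponentMk ⟨b, hbK⟩) := ⟨⟨b, hbK⟩, rfl, rfl⟩
    refine key ((G.induce K).connectedComponentMk ⟨b, hbK⟩)
      ⟨?_, .inl ⟨hbc, fun h ↦ hbP (Set.mem_iUnion_of_mem _ h)⟩, hab⟩
    rcases ha with ha | ha
    · exact .inl ha
    · obtain ⟨c, hac⟩ := Set.mem_iUnion.1 ha
      obtain ⟨⟨a, haK⟩, hc, rfl⟩ := hP c hac
      have hadj : (G.induce K).Adj ⟨a, haK⟩ ⟨b, hbK⟩ := hab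
      have hbc' : (⟨b, hbK⟩ : K) ∈ c.supp := c.mem_supp_of_adj_mem_supp hc hadj
      rw [ConnectedComponent.mem_supp_iff] at hbc'
      rw [hbc']
      exact .inr hac
  · rcases ha with ha | ha
    · exact .inr ⟨ha, hb, hab⟩
    · obtain ⟨c, hac⟩ := Set.mem_iUnion.1 ha
      exact key c ⟨.inr hac, .inr hb, hab⟩

/-- A region can be split at a finite connected set that touches both ends. -/
theorem IsFareyRegion.exists_split (hG : G.IsPiGraph) {X Y K : Set V}
    (h : G.IsFareyRegion X Y K) :
    ∃ Z K₁ K₂, Z ⊆ K ∧ K₁ ⊆ K ∧ K₂ ⊆ K ∧ Disjoint K₁ K₂ ∧ (G.induce Z).Connected ∧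
      G.Touches X Z ∧ G.Touches Z Y ∧ G.IsFareyRegion X Z K₁ ∧ G.IsFareyRegion Z Y K₂ := by
  obtain ⟨C, hCK, hC, hreg⟩ := h.exists_connected hG
  obtain ⟨S, hS, hhit⟩ := hG.exists_finite_hitting hreg.finite_left hreg.finite_right hreg.disjoint
    hreg.disjoint_left hreg.disjoint_right
  obtain ⟨x, hx, a, ha, hxa⟩ := hreg.touches_left
  obtain ⟨b, hb, y, hy, hby⟩ := hreg.touches_right
  obtain ⟨Z, hSZ, hZC, hZ, hZconn⟩ := exists_finite_connected_superset (S := {a, b} ∪ (S ∩ C)) hC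
    ((Set.toFinite {a, b}).union (hS.inter_of_left C))
    (by rintro z ((rfl | rfl) | hz); exacts [ha, hb, hz.2]) ⟨a, by simp⟩
  -- The part of `C \ Z` reachable from `X`. It has no edge to the rest of `C \ Z`, and none to `Y`
  -- because `Z` contains `S ∩ C`.
  let K₁ : Set V := {v | ∃ L ⊆ C \ Z, L.Finite ∧ (G.induce L).Connected ∧ G.Touches X L ∧ v ∈ L}
  have hK₁ : K₁ ⊆ C \ Z := by
    rintro v ⟨L, hL, -, -, -, hv⟩
    exact hL hv
  have hclosed : ∀ v ∈ K₁, ∀ w ∈ C \ Z, G.Adj v w → w ∈ K₁ := by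
    rintro v ⟨L, hL, hLfin, hLconn, hXL, hv⟩ w hw hvw
    refine ⟨L ∪ {w}, Set.union_subset hL (by simpa using hw), hLfin.union (Set.finite_singleton w),
      ?_, hXL.mono subset_rfl Set.subset_union_left, by simp⟩
    exact G.connected_induce_union hLconn.preconnected Preconnected.of_subsingleton hv
      (Set.mem_singleton w) hvw
  have hXK₁ : ∀ v ∈ X, ∀ w ∈ C \ Z, G.Adj v w → w ∈ K₁ := by
    intro v hv w hw hvw
    exact ⟨{w}, by simpa using hw, Set.finite_singleton w, Connected.mk Preconnected.of_subsingleton,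
      ⟨v, hv, w, rfl, hvw⟩, rfl⟩
  have hK₁Y : ∀ v ∈ K₁, ∀ w ∈ Y, ¬ G.Adj v w := by
    rintro v ⟨L, hL, hLfin, hLconn, hXL, hv⟩ w hw hvw
    obtain ⟨z, hz, hzS⟩ := hhit L (hL.trans Set.sdiff_subset)
      ⟨hLfin, hLconn, hXL, v, hv, w, hw, hvw⟩
    exact (hL hz).2 (hSZ (.inr ⟨hzS, (hL hz).1⟩))
  have hXY := G.finite_edgesBetween h.finite_left h.finite_right
  refine ⟨Z, K₁, (C \ Z) \ K₁, hZC.trans hCK, fun v hv ↦ hCK (hK₁ hv).1, fun v hv ↦ hCK hv.1.1,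
    Set.disjoint_sdiff_right, hZconn, ⟨x, hx, a, hSZ (by simp), hxa⟩,
    ⟨b, hSZ (by simp), y, hy, hby⟩, ⟨h.finite_left, hZ, ?_, ?_, ?_, ?_⟩,
    ⟨hZ, h.finite_right, ?_, ?_, ?_, ?_⟩⟩
  · exact hreg.disjoint_left.mono_right hZC
  · exact hreg.disjoint_left.mono_right fun v hv ↦ (hK₁ hv).1
  · exact Set.disjoint_left.2 fun v hv hv' ↦ (hK₁ hv').2 hv
  -- A finite cut between `X` and `Z` would, together with the finitely many `X`–`Y` edges, be a
  -- finite cut between `X` and `Y`.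
  · intro P hP hfin
    refine hreg.infinite_cut P (fun v hv ↦ (hK₁ (hP hv)).1) ((hfin.union hXY).subset ?_)
    rintro ⟨u, v⟩ ⟨hu, hv, huv⟩
    rcases hv with hv | hv
    · refine .inl ⟨hu, ?_, huv⟩
      by_cases hvZ : v ∈ Z
      · exact .inr hvZ
      · refine .inl ⟨?_, hv.2⟩
        rcases hu with hu | hu
        · exact hXK₁ u hu v ⟨hv.1, hvZ⟩ huv
        · exact hclosed u (hP hu) v ⟨hv.1, hvZ⟩ huv
    · rcases hu with hu | hu
      · exact .inr ⟨hu, hv, huv⟩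
      · exact absurd huv (hK₁Y u (hP hu) v hv)
  · exact (hreg.disjoint_right.mono_right hZC).symm
  · exact Set.disjoint_left.2 fun v hv hv' ↦ hv'.1.2 hv
  · exact hreg.disjoint_right.mono_right fun v hv ↦ hv.1.1
  · intro P hP hfin
    -- For a cut between `Z` and `Y`, all of `K₁` and `Z` joins the side of `X`.
    refine hreg.infinite_cut (K₁ ∪ Z ∪ P) (Set.union_subset (Set.union_subset
      (fun v hv ↦ (hK₁ hv).1) hZC) fun v hv ↦ (hP hv).1.1) ((hfin.union hXY).subset ?_)
    rintro ⟨u, v⟩ ⟨hu, hv, huv⟩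
    rcases hv with ⟨hvC, hvn⟩ | hv
    · have hv₁ : v ∉ K₁ := fun h ↦ hvn (.inl (.inl h))
      have hvZ : v ∈ C \ Z := ⟨hvC, fun h ↦ hvn (.inl (.inr h))⟩
      refine .inl ⟨?_, .inl ⟨⟨hvZ, hv₁⟩, fun h ↦ hvn (.inr h)⟩, huv⟩
      rcases hu with hu | (hu | hu) | hu
      · exact absurd (hXK₁ u hu v hvZ huv) hv₁
      · exact absurd (hclosed u hu v hvZ huv) hv₁
      · exact .inl hu
      · exact .inr hu
    · rcases hu with hu | (hu | hu) | hu
      · exact .inr ⟨hu, hv, huv⟩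
      · exact absurd huv (hK₁Y u hu v hv)
      · exact .inl ⟨.inl hu, .inr hv, huv⟩
      · exact .inl ⟨.inr hu, .inr hv, huv⟩

/-! ### Cells and the branch sets of a halved Farey graph -/

/-- Two disjoint connected adjacent branch sets together with a region between them, in which a
halved Farey graph on the edge between the two branch sets is to be found. -/
structure FareyCell (G : SimpleGraph V) where
  /-- the first branch set -/
  left : Set V
  /-- the second branch set -/
  right : Set V
  /-- the vertices that later branch sets may use -/
  region : Set V
  isFareyRegion : G.IsFareyRegion left right region
  left_connected : (G.induce left).Connected
  right_connected : (G.induce right).Connected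
  touches : G.Touches left right

namespace FareyCell

/-- `c₁` and `c₂` arise from `c` by inserting a new branch set between its two ends. -/
structure IsSplit (c c₁ c₂ : FareyCell G) : Prop where
  left_eq : c₁.left = c.left
  right_eq : c₂.right = c.right
  middle_eq : c₁.right = c₂.left
  middle_subset : c₁.right ⊆ c.region
  region_left_subset : c₁.region ⊆ c.region
  region_right_subset : c₂.region ⊆ c.region
  disjoint : Disjoint c₁.region c₂.region

theorem exists_isSplit (hG : G.IsPiGraph) (c : FareyCell G) :
    ∃ d : FareyCell G × FareyCell G, c.IsSplit d.1 d.2 := by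
  obtain ⟨Z, K₁, K₂, hZ, hK₁, hK₂, hdisj, hconn, hl, hr, h₁, h₂⟩ :=
    c.isFareyRegion.exists_split hG
  exact ⟨(⟨c.left, Z, K₁, h₁, c.left_connected, hconn, hl⟩,
    ⟨Z, c.right, K₂, h₂, hconn, c.right_connected, hr⟩), rfl, rfl, rfl, hZ, hK₁, hK₂, hdisj⟩

/-- The branch set of the fraction with coordinates `m` and `n` with respect to the two ends of the
cell, where `s` splits cells. Descending into a cell subtracts one coordinate from the other. -/
def branch (s : FareyCell G → FareyCell G × FareyCell G) : FareyCell G → ℕ → ℕ → Set V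
  | c, _, 0 => c.left
  | c, 0, _ + 1 => c.right
  | c, m + 1, n + 1 =>
    if n ≤ m then branch s (s c).1 (m - n) (n + 1) else branch s (s c).2 (m + 1) (n - m)
termination_by _ m n => m + n

variable {s : FareyCell G → FareyCell G × FareyCell G}

@[simp]
theorem branch_zero_right (c : FareyCell G) (m : ℕ) : branch s c m 0 = c.left := by
  cases m <;> rw [branch]

theorem branch_zero_left (c : FareyCell G) {n : ℕ} (hn : 0 < n) : branch s c 0 n = c.right := by
  obtain ⟨n, rfl⟩ := Nat.exists_eq_add_one.2 hn
  rw [branch]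

theorem branch_of_le (hs : ∀ c, IsSplit c (s c).1 (s c).2) (c : FareyCell G) {m n : ℕ}
    (h : n ≤ m) : branch s c m n = branch s (s c).1 (m - n) n := by
  cases n with
  | zero => simp [(hs c).left_eq]
  | succ n =>
    obtain ⟨m, rfl⟩ := Nat.exists_eq_add_one.2 (Nat.lt_of_lt_of_le (Nat.succ_pos n) h)
    rw [branch, if_pos (by omega), Nat.add_sub_add_right]

/-- On the diagonal the recursion enters the first cell, but either cell will do: the inserted set
is an end of both. -/
theorem branch_of_ge (hs : ∀ c, IsSplit c (s c).1 (s c).2) (c : FareyCell G) {m n : ℕ}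
    (h : m ≤ n) (hn : 0 < n) : branch s c m n = branch s (s c).2 m (n - m) := by
  rcases h.eq_or_lt with rfl | hlt
  · rw [branch_of_le hs c le_rfl, Nat.sub_self, branch_zero_left _ hn, branch_zero_right,
      (hs c).middle_eq]
  obtain ⟨n, rfl⟩ := Nat.exists_eq_add_one.2 hn
  cases m with
  | zero => rw [branch_zero_left _ hn, Nat.sub_zero, branch_zero_left _ hn, (hs c).right_eq]
  | succ m => rw [branch, if_neg (by omega), Nat.add_sub_add_right]

theorem branch_subset_region (hs : ∀ c, IsSplit c (s c).1 (s c).2) (c : FareyCell G) {m n : ℕ}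
    (hm : 0 < m) (hn : 0 < n) : branch s c m n ⊆ c.region := by
  induction hk : m + n using Nat.strong_induction_on generalizing c m n with
  | _ k ih =>
  subst hk
  rcases lt_trichotomy m n with h | rfl | h
  · rw [branch_of_ge hs c h.le hn]
    exact (ih _ (by omega) _ hm (Nat.sub_pos_of_lt h) rfl).trans (hs c).region_right_subset
  · rw [branch_of_le hs c le_rfl, Nat.sub_self, branch_zero_left _ hn]
    exact (hs c).middle_subset
  · rw [branch_of_le hs c h.le]
    exact (ih _ (by omega) _ (Nat.sub_pos_of_lt h) hn rfl).trans (hs c).region_left_subset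

theorem branch_finite_connected (hs : ∀ c, IsSplit c (s c).1 (s c).2) (c : FareyCell G)
    (m n : ℕ) : (branch s c m n).Finite ∧ (G.induce (branch s c m n)).Connected := by
  induction hk : m + n using Nat.strong_induction_on generalizing c m n with
  | _ k ih =>
  subst hk
  rcases Nat.eq_zero_or_pos n with rfl | hn
  · rw [branch_zero_right]
    exact ⟨c.isFareyRegion.finite_left, c.left_connected⟩
  rcases Nat.eq_zero_or_pos m with rfl | hm
  · rw [branch_zero_left _ hn]
    exact ⟨c.isFareyRegion.finite_right, c.right_connected⟩
  rcases le_total m n with h | h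
  · rw [branch_of_ge hs c h hn]
    exact ih _ (by omega) _ _ _ rfl
  · rw [branch_of_le hs c h]
    exact ih _ (by omega) _ _ _ rfl

/-- Determinant 1 forces both pairs weakly onto the same side of the diagonal, so both descend into
the same cell with the determinant unchanged. The only exception is (1, 0) with (0, 1), the two ends
of the cell. -/
theorem touches_branch (hs : ∀ c, IsSplit c (s c).1 (s c).2) (c : FareyCell G) {m n m' n' : ℕ}
    (hdet : m * n' = n * m' + 1) : G.Touches (branch s c m n) (branch s c m' n') := by
  induction hk : m + n + m' + n' using Nat.strong_induction_on generalizing c m n m' n' with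
  | _ k ih =>
  subst hk
  have hm : 0 < m := Nat.pos_of_ne_zero (by rintro rfl; omega)
  have hn' : 0 < n' := Nat.pos_of_ne_zero (by rintro rfl; omega)
  by_cases h : n ≤ m
  · by_cases h' : n' ≤ m'
    · rw [branch_of_le hs c h, branch_of_le hs c h']
      refine ih _ (by omega) _ ?_ rfl
      zify [h, h'] at hdet ⊢
      linarith
    · rcases Nat.eq_zero_or_pos n with rfl | hn
      · rcases Nat.eq_zero_or_pos m' with rfl | hm'
        · rw [branch_zero_right, branch_zero_left _ hn']
          exact c.touches
        · have := Nat.eq_one_of_mul_eq_one_left (show m * n' = 1 by omega)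
          omega
      · rcases h.eq_or_lt with rfl | hlt
        · have hle : m' ≤ n' := by omega
          rw [branch_of_ge hs c le_rfl hn, branch_of_ge hs c hle hn']
          refine ih _ (by omega) _ ?_ rfl
          rw [Nat.sub_self, zero_mul]
          zify [hle] at hdet ⊢
          linarith
        · nlinarith
  · have h'' : m' ≤ n' := by
      by_contra hlt
      nlinarith
    rw [branch_of_ge hs c (by omega) (by omega), branch_of_ge hs c h'' hn']
    have hle : m ≤ n := by omega
    refine ih _ (by omega) _ ?_ rfl
    zify [hle, h''] at hdet ⊢
    linarith

theorem disjoint_branch_of_lt (hs : ∀ c, IsSplit c (s c).1 (s c).2) (c : FareyCell G)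
    {m n m' n' : ℕ} (hlt : n < m) (hlt' : m' < n') :
    Disjoint (branch s c m n) (branch s c m' n') := by
  have hl : n = 0 ∨ branch s c m n ⊆ (s c).1.region := by
    refine n.eq_zero_or_pos.imp_right fun hn ↦ ?_
    rw [branch_of_le hs c hlt.le]
    exact branch_subset_region hs _ (Nat.sub_pos_of_lt hlt) hn
  have hr : m' = 0 ∨ branch s c m' n' ⊆ (s c).2.region := by
    refine m'.eq_zero_or_pos.imp_right fun hm ↦ ?_
    rw [branch_of_ge hs c hlt'.le (by omega)]
    exact branch_subset_region hs _ hm (Nat.sub_pos_of_lt hlt')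
  rcases hl with rfl | hl <;> rcases hr with rfl | hr
  · rw [branch_zero_right, branch_zero_left _ hlt']
    exact c.isFareyRegion.disjoint
  · rw [branch_zero_right]
    exact c.isFareyRegion.disjoint_left.mono_right (hr.trans (hs c).region_right_subset)
  · rw [branch_zero_left _ hlt']
    exact (c.isFareyRegion.disjoint_right.mono_right
      (hl.trans (hs c).region_left_subset)).symm
  · exact (hs c).disjoint.mono hl hr

/-- Both pairs descend together until the diagonal separates them strictly. Coprimality rules out
the only way to stall, two distinct pairs on the same axis. -/
theorem disjoint_branch (hs : ∀ c, IsSplit c (s c).1 (s c).2) (c : FareyCell G) {m n m' n' : ℕ}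
    (h : m.Coprime n) (h' : m'.Coprime n') (hne : (m, n) ≠ (m', n')) :
    Disjoint (branch s c m n) (branch s c m' n') := by
  induction hk : m + n + m' + n' using Nat.strong_induction_on generalizing c m n m' n' with
  | _ k ih =>
  subst hk
  by_cases hle : n ≤ m ∧ n' ≤ m'
  · obtain ⟨hl, hl'⟩ := hle
    rw [branch_of_le hs c hl, branch_of_le hs c hl']
    refine ih _ ?_ _ ((Nat.coprime_sub_self_left hl).2 h) ((Nat.coprime_sub_self_left hl').2 h')
      ?_ rfl
    · by_contra hcon
      obtain rfl : n = 0 := by omega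
      obtain rfl : n' = 0 := by omega
      simp_all
    · rw [Ne, Prod.mk.injEq] at hne ⊢
      omega
  by_cases hge : m ≤ n ∧ m' ≤ n'
  · obtain ⟨hg, hg'⟩ := hge
    have hn : 0 < n := Nat.pos_of_ne_zero fun h0 ↦ hle (by simp_all)
    have hn' : 0 < n' := Nat.pos_of_ne_zero fun h0 ↦ hle (by simp_all)
    rw [branch_of_ge hs c hg hn, branch_of_ge hs c hg' hn']
    refine ih _ ?_ _ ((Nat.coprime_sub_self_right hg).2 h) ((Nat.coprime_sub_self_right hg').2 h')
      ?_ rfl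
    · by_contra hcon
      obtain rfl : m = 0 := by omega
      obtain rfl : m' = 0 := by omega
      simp_all
    · rw [Ne, Prod.mk.injEq] at hne ⊢
      omega
  by_cases hlt : n < m
  · exact disjoint_branch_of_lt hs c hlt (by omega)
  · exact (disjoint_branch_of_lt hs c (by omega) (by omega)).symm

end FareyCell

/-! ### The two initial cells -/

theorem IsFareyRegion.mono_left {X X' Y K : Set V} (h : G.IsFareyRegion X Y K) (hX : X ⊆ X')
    (hfin : X'.Finite) (hY : Disjoint X' Y) (hK : Disjoint X' K) : G.IsFareyRegion X' Y K where
  finite_left := hfin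
  finite_right := h.finite_right
  disjoint := hY
  disjoint_left := hK
  disjoint_right := h.disjoint_right
  infinite_cut P hP := (h.infinite_cut P hP).mono fun _ hp ↦
    ⟨Set.union_subset_union_left P hX hp.1, hp.2⟩

/-- Every `Π`-graph contains two cells that differ only in their disjoint regions. -/
theorem IsPiGraph.exists_fareyCell_pair (hG : G.IsPiGraph) :
    ∃ c d : FareyCell G, c.left = d.left ∧ c.right = d.right ∧ Disjoint c.region d.region := by
  have := hG.1.1
  obtain ⟨u, v, huv⟩ := exists_pair_ne V
  have hreach : G.Reachable u v := by
    have h := hG.1.2 1 u v (s := ∅) (by simp)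
    rwa [deleteEdges_empty] at h
  obtain ⟨p⟩ := hreach
  obtain ⟨e, -, -, -⟩ := p.exists_boundary_dart {u} rfl huv.symm
  obtain ⟨⟨x, y⟩, hxy⟩ := e
  -- With all other vertices available, this is infinite edge-connectivity.
  have hreg : G.IsFareyRegion {x} {y} {x, y}ᶜ := by
    refine ⟨Set.finite_singleton x, Set.finite_singleton y, by simpa using hxy.ne,
      by simp, by simp, fun P hP ↦ ?_⟩
    have hy : y ∉ {x} ∪ P := by
      rintro (h | h)
      · exact hxy.ne h.symm
      · exact hP h (by simp)
    refine (infinite_edgesBetween_compl hG.1 (P := {x} ∪ P) (.inl rfl) hy).mono ?_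
    rintro ⟨a, b⟩ ⟨ha, hb, hab⟩
    refine ⟨ha, ?_, hab⟩
    by_cases hby : b = y
    · exact .inr hby
    · exact .inl ⟨by rintro (h | h); exacts [hb (.inl h), hby h], fun h ↦ hb (.inr h)⟩
  obtain ⟨Z, K₁, K₂, hZ, hK₁, hK₂, hdisj, hconn, hl, hr, h₁, h₂⟩ := hreg.exists_split hG
  have hW : (G.induce {x, y}).Connected := induce_pair_connected_of_adj hxy
  have hWfin : ({x, y} : Set V).Finite := Set.toFinite _
  have hdis : ∀ {A : Set V}, A ⊆ {x, y}ᶜ → Disjoint {x, y} A := fun h ↦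
    disjoint_compl_right.mono_right h
  -- Merging the adjacent vertices `x` and `y` into one branch set turns the two successive regions
  -- into parallel ones, both between `{x, y}` and `Z`.
  refine ⟨⟨{x, y}, Z, K₁, h₁.mono_left (by simp) hWfin (hdis hZ) (hdis hK₁), hW, hconn,
      hl.mono (by simp) subset_rfl⟩,
    ⟨{x, y}, Z, K₂, h₂.symm.mono_left (by simp) hWfin (hdis hZ) (hdis hK₂), hW, hconn,
      hr.symm.mono (by simp) subset_rfl⟩, rfl, rfl, hdisj⟩


end SimpleGraph

open SimpleGraph

/-! ### Coordinates in the Farey graph -/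

theorem fareyDen_nonneg (x : OnePoint ℚ) : 0 ≤ fareyDen x := by
  cases x with
  | infty => exact le_rfl
  | coe q => exact Int.natCast_nonneg _

theorem coprime_fareyNum_fareyDen (x : OnePoint ℚ) :
    (fareyNum x).natAbs.Coprime (fareyDen x).natAbs := by
  cases x with
  | infty => simp [fareyNum, fareyDen]
  | coe q => exact q.reduced

theorem fareyNum_eq_one_of_fareyDen_eq_zero {x : OnePoint ℚ} (h : fareyDen x = 0) :
    fareyNum x = 1 := by
  cases x with
  | infty => rfl
  | coe q => exact absurd h (Int.natCast_ne_zero.2 q.den_ne_zero)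

theorem eq_of_fareyNum_eq_of_fareyDen_eq {x y : OnePoint ℚ} (h : fareyNum x = fareyNum y)
    (h' : fareyDen x = fareyDen y) : x = y := by
  cases x with
  | infty =>
    cases y with
    | infty => rfl
    | coe q => exact absurd h'.symm (Int.natCast_ne_zero.2 q.den_ne_zero)
  | coe p =>
    cases y with
    | infty => exact absurd h' (Int.natCast_ne_zero.2 p.den_ne_zero)
    | coe q => exact congrArg _ (Rat.ext h (Int.natCast_inj.1 h'))

theorem fareyGraph_adj {x y : OnePoint ℚ} :
    fareyGraph.Adj x y ↔ fareyNum x * fareyDen y - fareyNum y * fareyDen x = 1 ∨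
      fareyNum x * fareyDen y - fareyNum y * fareyDen x = -1 := by
  simp [fareyGraph, Matrix.det_fin_two_of]

/-- Both vertices lie in `[0, ∞]`, or both lie in `[∞, 0]`. -/
def FareySameSide (x y : OnePoint ℚ) : Prop :=
  (0 ≤ fareyNum x ∧ 0 ≤ fareyNum y) ∨
    ((fareyNum x ≤ 0 ∨ fareyDen x = 0) ∧ (fareyNum y ≤ 0 ∨ fareyDen y = 0))

theorem FareySameSide.eq_of_natAbs_eq {x y : OnePoint ℚ} (h : FareySameSide x y)
    (heq : ((fareyNum x).natAbs, (fareyDen x).natAbs) =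
      ((fareyNum y).natAbs, (fareyDen y).natAbs)) : x = y := by
  rw [Prod.mk.injEq] at heq
  have hx := fareyDen_nonneg x
  have hy := fareyDen_nonneg y
  have hx' := @fareyNum_eq_one_of_fareyDen_eq_zero x
  have hy' := @fareyNum_eq_one_of_fareyDen_eq_zero y
  rw [FareySameSide] at h
  exact eq_of_fareyNum_eq_of_fareyDen_eq (by omega) (by omega)

theorem FareySameSide.natAbs_det_of_adj {x y : OnePoint ℚ} (h : FareySameSide x y) (hxy : fareyGraph.Adj x y) :
    (fareyNum x).natAbs * (fareyDen y).natAbs = (fareyDen x).natAbs * (fareyNum y).natAbs + 1 ∨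
    (fareyNum y).natAbs * (fareyDen x).natAbs = (fareyDen y).natAbs * (fareyNum x).natAbs + 1 := by
  rw [fareyGraph_adj] at hxy
  have hx := fareyDen_nonneg x
  have hy := fareyDen_nonneg y
  have hx' := @fareyNum_eq_one_of_fareyDen_eq_zero x
  have hy' := @fareyNum_eq_one_of_fareyDen_eq_zero y
  zify
  rw [abs_of_nonneg hx, abs_of_nonneg hy]
  rcases h with ⟨h₁, h₂⟩ | ⟨h₁ | h₁, h₂ | h₂⟩
  · rw [abs_of_nonneg h₁, abs_of_nonneg h₂]
    exact hxy.imp (fun h ↦ by linarith) fun h ↦ by linarith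
  -- Negating both numerators flips the sign of the determinant.
  · rw [abs_of_nonpos h₁, abs_of_nonpos h₂]
    exact hxy.symm.imp (fun h ↦ by linarith) fun h ↦ by linarith
  · rw [hy' h₂, h₂] at hxy ⊢
    right
    simp only [abs_one]
    omega
  · rw [hx' h₁, h₁] at hxy ⊢
    left
    simp only [abs_one]
    omega
  · simp [h₁, h₂] at hxy

/-- Every `Π`-graph contains the Farey graph as a tight minor. -/
theorem theorem2 {V : Type*} (G : SimpleGraph V) (hG : G.IsPiGraph) :
    fareyGraph.IsTightMinor G := by
  obtain ⟨c, d, hl, hr, hcd⟩ := hG.exists_fareyCell_pair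
  choose s hs using FareyCell.exists_isSplit hG
  let f : OnePoint ℚ → Set V := fun x ↦
    FareyCell.branch s (if 0 ≤ fareyNum x then c else d) (fareyNum x).natAbs (fareyDen x).natAbs
  have hfc : ∀ x, 0 ≤ fareyNum x →
      f x = FareyCell.branch s c (fareyNum x).natAbs (fareyDen x).natAbs := by
    intro x hx
    simp only [f, if_pos hx]
  have hfd : ∀ x, fareyNum x ≤ 0 ∨ fareyDen x = 0 →
      f x = FareyCell.branch s d (fareyNum x).natAbs (fareyDen x).natAbs := by
    intro x hx
    by_cases h0 : 0 ≤ fareyNum x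
    -- Only 0 and ∞ occur here; they are assigned the common ends of `c` and `d`.
    · rw [hfc x h0]
      rcases hx with hx | hx
      · have hz := le_antisymm hx h0
        have hcop := coprime_fareyNum_fareyDen x
        rw [hz, Int.natAbs_zero, Nat.coprime_zero_left] at hcop
        rw [hz, hcop, Int.natAbs_zero, FareyCell.branch_zero_left _ one_pos,
          FareyCell.branch_zero_left _ one_pos, hr]
      · rw [hx, Int.natAbs_zero, FareyCell.branch_zero_right, FareyCell.branch_zero_right, hl]
    · simp only [f, if_neg h0]
  have hside : ∀ x y, (0 ≤ fareyNum x ∧ 0 ≤ fareyNum y) ∨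
      ((fareyNum x ≤ 0 ∨ fareyDen x = 0) ∧ (fareyNum y ≤ 0 ∨ fareyDen y = 0)) ∨
      (0 < fareyNum x ∧ 0 < fareyDen x ∧ fareyNum y < 0 ∧ 0 < fareyDen y) ∨
      (0 < fareyNum y ∧ 0 < fareyDen y ∧ fareyNum x < 0 ∧ 0 < fareyDen x) := by
    intro x y
    have hx := fareyDen_nonneg x
    have hy := fareyDen_nonneg y
    have hx' := @fareyNum_eq_one_of_fareyDen_eq_zero x
    have hy' := @fareyNum_eq_one_of_fareyDen_eq_zero y
    omega
  have hopp : ∀ x y, 0 < fareyNum x → 0 < fareyDen x → fareyNum y < 0 → 0 < fareyDen y →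
      Disjoint (f x) (f y) ∧ ¬ fareyGraph.Adj x y := by
    intro x y h₁ h₂ h₃ h₄
    constructor
    · rw [hfc x h₁.le, hfd y (.inl h₃.le)]
      exact hcd.mono
        (FareyCell.branch_subset_region hs c (Int.natAbs_pos.2 h₁.ne') (Int.natAbs_pos.2 h₂.ne'))
        (FareyCell.branch_subset_region hs d (Int.natAbs_pos.2 h₃.ne) (Int.natAbs_pos.2 h₄.ne'))
    · intro h
      -- The determinant is a sum of two positive integers, hence at least 2.
      have hdet := fareyGraph_adj.1 h
      have := mul_pos h₁ h₄
      have := mul_pos (neg_pos.2 h₃) h₂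
      rcases hdet with hdet | hdet <;> linarith
  refine ⟨⟨f, fun x ↦ (FareyCell.branch_finite_connected hs _ _ _).2, ?_, ?_⟩,
    fun x ↦ (FareyCell.branch_finite_connected hs _ _ _).1⟩
  · intro x y hxy
    have hx := coprime_fareyNum_fareyDen x
    have hy := coprime_fareyNum_fareyDen y
    rcases hside x y with ⟨h₁, h₂⟩ | ⟨h₁, h₂⟩ | ⟨h₁, h₂, h₃, h₄⟩ | ⟨h₁, h₂, h₃, h₄⟩
    · rw [hfc x h₁, hfc y h₂]
      refine FareyCell.disjoint_branch hs c hx hy fun h ↦ hxy ?_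
      exact FareySameSide.eq_of_natAbs_eq (.inl ⟨h₁, h₂⟩) h
    · rw [hfd x h₁, hfd y h₂]
      refine FareyCell.disjoint_branch hs d hx hy fun h ↦ hxy ?_
      exact FareySameSide.eq_of_natAbs_eq (.inr ⟨h₁, h₂⟩) h
    · exact (hopp x y h₁ h₂ h₃ h₄).1
    · exact (hopp y x h₁ h₂ h₃ h₄).1.symm
  · intro x y hxy
    rcases hside x y with ⟨h₁, h₂⟩ | ⟨h₁, h₂⟩ | ⟨h₁, h₂, h₃, h₄⟩ | ⟨h₁, h₂, h₃, h₄⟩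
    · rw [hfc x h₁, hfc y h₂]
      rcases FareySameSide.natAbs_det_of_adj (.inl ⟨h₁, h₂⟩) hxy with h | h
      · exact FareyCell.touches_branch hs c h
      · exact (FareyCell.touches_branch hs c h).symm
    · rw [hfd x h₁, hfd y h₂]
      rcases FareySameSide.natAbs_det_of_adj (.inr ⟨h₁, h₂⟩) hxy with h | h
      · exact FareyCell.touches_branch hs d h
      · exact (FareyCell.touches_branch hs d h).symm
    · exact absurd hxy (hopp x y h₁ h₂ h₃ h₄).2
    · exact absurd hxy.symm (hopp y x h₁ h₂ h₃ h₄).2
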